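/- Let $d\ge 1$ and let $\widehat{\mathbb C}=\mathbb C\cup\{\infty\}$ be the Riemann sphere. A polynomial $f(x,y)=\sum_{0\le i,j\le d}A_{(i,j)}x^iy^j\in\mathbb C[x,y]$ is called a correspondence of degree $d$ if (1) for all but finitely many $x\in\mathbb C$ the polynomial $f(x,\cdot)$ has exactly $d$ complex roots counted with multiplicity, and for all but finitely many $y\in\mathbb C$ so has $f(\cdot,y)$; and (2) the biprojective completion $\Gamma_f\subset\widehat{\mathbb C}\times\widehat{\mathbb C}$ of $\{f=0\}$, i.e. the zero locus of the bihomogenization $F([\xi:x],[\zeta:y])=\sum_{i,j}A_{(i,j)}x^i\xi^{d-i}y^j\zeta^{d-j}$, has no irreducible component of the form $\{a\}\times\widehat{\mathbb C}$ or $\widehat{\mathbb C}\times\{a\}$ with $a\in\widehat{\mathbb C}$. For $x_1\in\widehat{\mathbb C}$ let $Y(x_1)$ be the multiset of the $d$ points $y\in\widehat{\mathbb C}$ with $(x_1,y)\in\Gamma_f$, each repeated according to its multiplicity as a zero of the binary form $F(x_1,\cdot)$ of degree $d$; for $y_1\in\widehat{\mathbb C}$ define the multiset $X(y_1)$ of $d$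 points of $\widehat{\mathbb C}$ analogously from $F(\cdot,y_1)$. A correspondence $f$ of degree $d$ is called a map of $d$-tuples if $X(y)=X(y')$ for all $x_1\in\widehat{\mathbb C}$ and all $y,y'\in Y(x_1)$, and $Y(x)=Y(x')$ for all $y_1\in\widehat{\mathbb C}$ and all $x,x'\in X(y_1)$. **Theorem.** Let $f_d\in\mathbb C[x,y]$ be a correspondence of degree $d\ge1$ that cannot be written as $f_d=[g_k]^{d/k}$ with $k\mid d$, $k\ne d$, and $g_k\in\mathbb C[x,y]$ a map of $k$-tuples. Then $f_d$ is a map of $d$-tuples if and only if the variables in the equation $f_d(x,y)=0$ can be separated, i.e. the equation can be rewritten as $\Phi(x)=\Psi(y)$ with rational functions $\Phi,\Psi$ over $\mathbb C$ of degree $d$: there are $\Phi=P/Q$ and $\Psi=R/S$ with $P,Q$ coprime polynomials, $R,S$ coprime polynomials, $\max(\deg P,\deg Q)=\max(\deg R,\deg S)=d$, and a constant $c\in\mathbb C\setminus\{0\}$, such that $$f_d(x,y)=c\,\bigl(P(x)S(y)-Q(x)R(y)\bigr).$$ -/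

import Mathlib

noncomputable section

namespace PolyCorr

open Polynomial

/-- The coefficient `A_(i,j)` of `x ^ i * y ^ j` in `f ∈ ℂ[x, y]`. A bivariate polynomial is an
element of `ℂ[x][y]`: the inner variable is `x`, the outer variable is `y`. -/
def coeffXY (f : Polynomial (Polynomial ℂ)) (i j : ℕ) : ℂ := (f.coeff j).coeff i

/-- Homogeneous coordinates on the Riemann sphere: the point `z ∈ ℂ` is `[1 : z]` and the point
`∞` is `[0 : 1]`. -/
def hcoords : OnePoint ℂ → ℂ × ℂ
  | none => (0, 1)
  | some z => (1, z)

/-- The bihomogenization of bidegree `(d, d)`,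
`F([ξ : x], [ζ : y]) = ∑ A_(i,j) x ^ i ξ ^ (d - i) y ^ j ζ ^ (d - j)`,
evaluated at `p = (ξ, x)`, `q = (ζ, y)`. -/
def biform (d : ℕ) (f : Polynomial (Polynomial ℂ)) (p q : ℂ × ℂ) : ℂ :=
  ∑ i ∈ Finset.range (d + 1), ∑ j ∈ Finset.range (d + 1),
    coeffXY f i j * (p.2 ^ i * p.1 ^ (d - i)) * (q.2 ^ j * q.1 ^ (d - j))

/-- The biprojective completion of `{f = 0}` in the product of two Riemann spheres. -/
def graph (d : ℕ) (f : Polynomial (Polynomial ℂ)) : Set (OnePoint ℂ × OnePoint ℂ) :=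
  {p | biform d f (hcoords p.1) (hcoords p.2) = 0}

/-- The binary form `F(p, [ζ : y])` of degree `d`, dehomogenized at `ζ = 1`. -/
def sliceY (d : ℕ) (f : Polynomial (Polynomial ℂ)) (p : ℂ × ℂ) : Polynomial ℂ :=
  ∑ j ∈ Finset.range (d + 1),
    C (∑ i ∈ Finset.range (d + 1), coeffXY f i j * (p.2 ^ i * p.1 ^ (d - i))) * X ^ j

/-- The binary form `F([ξ : x], q)` of degree `d`, dehomogenized at `ξ = 1`. -/
def sliceX (d : ℕ) (f : Polynomial (Polynomial ℂ)) (q : ℂ × ℂ) : Polynomial ℂ :=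
  ∑ i ∈ Finset.range (d + 1),
    C (∑ j ∈ Finset.range (d + 1), coeffXY f i j * (q.2 ^ j * q.1 ^ (d - j))) * X ^ i

/-- The zeros on the Riemann sphere, with multiplicity, of the nonzero binary form of degree `d`
whose dehomogenization is `p` (so `p` has degree at most `d`): the roots of `p`, together with
the point `∞` with multiplicity `d - deg p`. -/
def sphereRoots (d : ℕ) (p : Polynomial ℂ) : Multiset (OnePoint ℂ) :=
  p.roots.map (fun z : ℂ => (z : OnePoint ℂ)) + Multiset.replicate (d - p.natDegree) OnePoint.infty

/-- The points of `Π_y (Π_x⁻¹ {x} ∩ Γ_f)`, repeated according to intersection multiplicity. -/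
def fiberY (d : ℕ) (f : Polynomial (Polynomial ℂ)) (x : OnePoint ℂ) : Multiset (OnePoint ℂ) :=
  sphereRoots d (sliceY d f (hcoords x))

/-- The points of `Π_x (Π_y⁻¹ {y} ∩ Γ_f)`, repeated according to intersection multiplicity. -/
def fiberX (d : ℕ) (f : Polynomial (Polynomial ℂ)) (y : OnePoint ℂ) : Multiset (OnePoint ℂ) :=
  sphereRoots d (sliceX d f (hcoords y))

/-- `f` is a polynomial correspondence of degree `d`: `f(x, ·)` and `f(·, y)` are generically
`d`-valued (counting multiplicity), and the biprojective completion of `{f = 0}` contains no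
vertical or horizontal line. (Such lines are irreducible curves, so one that is contained in the
curve is the same as one that is an irreducible component of it.) -/
structure IsCorrespondence (d : ℕ) (f : Polynomial (Polynomial ℂ)) : Prop where
  generic_x : {x : ℂ | Multiset.card (f.map (evalRingHom x)).roots ≠ d}.Finite
  generic_y : {y : ℂ | Multiset.card (f.eval (C y)).roots ≠ d}.Finite
  no_vertical : ∀ a : OnePoint ℂ, ¬ ({a} : Set (OnePoint ℂ)) ×ˢ Set.univ ⊆ graph d f
  no_horizontal : ∀ a : OnePoint ℂ, ¬ Set.univ ×ˢ ({a} : Set (OnePoint ℂ)) ⊆ graph d f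

/-- `f` is a map of `d`-tuples: a correspondence of degree `d` such that for each `x₁` the `d`
fibres over the points `y_j(x₁)` coincide as lists with multiplicity, and likewise with the roles
of `x` and `y` exchanged. -/
structure IsMapOfTuples (d : ℕ) (f : Polynomial (Polynomial ℂ)) : Prop where
  corr : IsCorrespondence d f
  coincide_x : ∀ x₁ : OnePoint ℂ, ∀ y ∈ fiberY d f x₁, ∀ y' ∈ fiberY d f x₁,
    fiberX d f y = fiberX d f y'
  coincide_y : ∀ y₁ : OnePoint ℂ, ∀ x ∈ fiberX d f y₁, ∀ x' ∈ fiberX d f y₁,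
    fiberY d f x = fiberY d f x'

/-- The degree of a rational function in lowest terms, i.e. its degree as a self-map of the
Riemann sphere. -/
def ratDegree (Φ : RatFunc ℂ) : ℕ := max Φ.num.natDegree Φ.denom.natDegree

/-- The numerator `num Φ(x) * denom Ψ(y) - num Ψ(y) * denom Φ(x)` of `Φ(x) - Ψ(y)`. -/
def separatedPoly (Φ Ψ : RatFunc ℂ) : Polynomial (Polynomial ℂ) :=
  C Φ.num * Ψ.denom.map C - C Φ.denom * Ψ.num.map C

/-- The equation `f(x, y) = 0` can be rewritten as `Φ(x) = Ψ(y)` with rational functions of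
degree `d`: after clearing denominators, the second equation is the first one up to a nonzero
constant factor. -/
def IsSeparable (d : ℕ) (f : Polynomial (Polynomial ℂ)) : Prop :=
  ∃ Φ Ψ : RatFunc ℂ, ratDegree Φ = d ∧ ratDegree Ψ = d ∧
    ∃ c : ℂ, c ≠ 0 ∧ f = C (C c) * separatedPoly Φ Ψ

end PolyCorr

end

noncomputable section

namespace PolyCorr

open Polynomial Polynomial.Bivariate

/-! For a correspondence, separability amounts to a bilinear shape `f = P(x) a(y) + Q(x) b(y)` with
all four degrees at most `d`. The absence of lines in the curve says that neither pair has a common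
zero on the sphere, so `P / Q` and `-b / a` have degree exactly `d` (`isSeparable_of_bilinear`).

Given this shape, a zero `(x₀, y)` forces `[a(y) : b(y)] = [Q(x₀) : -P(x₀)]`. The slice through `y`
is then proportional to `Q(x₀) P - P(x₀) Q`, whichever `y` over `x₀` is taken
(`fiberX_eq_of_bilinear`); the other direction is symmetric.

Conversely, let `f` be a map of tuples. Over a generic `x`, a zero `y` of an irreducible factor of
multiplicity `m` has `x` in its fibre exactly `m` times. Coinciding fibres thus force one common
`m`, so `f = g ^ m` with `g` again a map of tuples, and the hypothesis on powers gives `m = 1`.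
Generic fibres then consist of `d` distinct points.

Let `a(y)` be the leading coefficient of `f` in `x` and `b(y)` another coefficient not proportional
to it. Since slices through points of one fibre are proportional, `[a : b]` is constant on the fibre
over `x`. Hence `b(y₀) a - a(y₀) b`, of degree at most `d`, vanishes at all `d` points and is
proportional to `f(x, ·)`. So `f(x, ·)` lies in the span of `a` and `b` for infinitely many `x`, and
Cramer's rule makes the coefficients polynomials in `x`. -/

/-! ### Exchange of variables, slices and lines -/

theorem coeff_coeff_swap (f : ℂ[X][Y]) (i j : ℕ) :
    ((swap f).coeff i).coeff j = (f.coeff j).coeff i := by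
  induction f using Polynomial.induction_on' with
  | add p q hp hq => simp [hp, hq]
  | monomial n a =>
    induction a using Polynomial.induction_on' with
    | add p q hp hq => simp only [map_add, coeff_add, hp, hq]
    | monomial m r =>
      rw [swap_monomial_monomial]
      simp only [coeff_monomial]
      split_ifs <;> simp_all [coeff_monomial]

theorem coeffXY_swap (f : ℂ[X][Y]) (i j : ℕ) : coeffXY (swap f) i j = coeffXY f j i :=
  coeff_coeff_swap f j i

theorem evalEval_swap (f : ℂ[X][Y]) (x y : ℂ) :
    (swap f).evalEval y x = f.evalEval x y := by
  simpa only [coe_aevalAeval_eq_evalEval] using aevalAeval_swap y x f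

theorem eval_map_evalRingHom (f : ℂ[X][Y]) (x y : ℂ) :
    (f.map (evalRingHom x)).eval y = f.evalEval x y :=
  map_evalRingHom_eval x y f

theorem eval_C_eq_map_swap (f : ℂ[X][Y]) (y : ℂ) :
    f.eval (C y) = (swap f).map (evalRingHom y) := by
  refine Polynomial.funext fun x => ?_
  rw [eval_map_evalRingHom, evalEval_swap]

theorem natDegree_coeff_le_natDegree_swap (f : ℂ[X][Y]) (j : ℕ) :
    (f.coeff j).natDegree ≤ (swap f).natDegree := by
  refine natDegree_le_iff_coeff_eq_zero.2 fun i hi => ?_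
  rw [← coeff_coeff_swap, coeff_eq_zero_of_natDegree_lt hi, coeff_zero]

theorem natDegree_swap_le {f : ℂ[X][Y]} {d : ℕ} (h : ∀ j, (f.coeff j).natDegree ≤ d) :
    (swap f).natDegree ≤ d := by
  refine natDegree_le_iff_coeff_eq_zero.2 fun i hi => ?_
  ext j
  rw [coeff_coeff_swap, coeff_eq_zero_of_natDegree_lt ((h j).trans_lt hi), coeff_zero]

theorem sliceX_eq_sliceY_swap (d : ℕ) (f : ℂ[X][Y]) (q : ℂ × ℂ) :
    sliceX d f q = sliceY d (swap f) q := by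
  simp only [sliceX, sliceY, coeffXY_swap]

theorem fiberX_eq_fiberY_swap (d : ℕ) (f : ℂ[X][Y]) (y : OnePoint ℂ) :
    fiberX d f y = fiberY d (swap f) y := by
  rw [fiberX, fiberY, sliceX_eq_sliceY_swap]

theorem fiberY_eq_fiberX_swap (d : ℕ) (f : ℂ[X][Y]) (x : OnePoint ℂ) :
    fiberY d f x = fiberX d (swap f) x := by
  rw [fiberX_eq_fiberY_swap, swap_swap_apply]

theorem biform_swap (d : ℕ) (f : ℂ[X][Y]) (p q : ℂ × ℂ) :
    biform d (swap f) q p = biform d f p q := by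
  rw [biform, biform, Finset.sum_comm]
  refine Finset.sum_congr rfl fun i _ => Finset.sum_congr rfl fun j _ => ?_
  rw [coeffXY_swap]
  ring

theorem coeff_sliceY (d : ℕ) (f : ℂ[X][Y]) (p : ℂ × ℂ) (n : ℕ) :
    (sliceY d f p).coeff n = if n ≤ d then
      ∑ i ∈ Finset.range (d + 1), coeffXY f i n * (p.2 ^ i * p.1 ^ (d - i)) else 0 := by
  simp [sliceY, coeff_C_mul, coeff_X_pow, -map_sum]

theorem natDegree_sliceY_le (d : ℕ) (f : ℂ[X][Y]) (p : ℂ × ℂ) :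
    (sliceY d f p).natDegree ≤ d := by
  refine natDegree_le_iff_coeff_eq_zero.2 fun i hi => ?_
  rw [coeff_sliceY, if_neg (by omega)]

theorem hcoords_coe (z : ℂ) : hcoords (z : OnePoint ℂ) = (1, z) := rfl

theorem hcoords_infty : hcoords (OnePoint.infty : OnePoint ℂ) = (0, 1) := rfl

/-- The degree bounds ensure that the truncation at `d` built into `sliceY` loses no coefficient. -/
theorem sliceY_coe {d : ℕ} {f : ℂ[X][Y]} (hf : f.natDegree ≤ d) (hs : (swap f).natDegree ≤ d)
    (z : ℂ) : sliceY d f (hcoords z) = f.map (evalRingHom z) := by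
  ext n
  rw [coeff_sliceY, hcoords_coe, coeff_map, coe_evalRingHom]
  split_ifs with h
  · rw [eval_eq_sum_range' (Nat.lt_succ_of_le ((natDegree_coeff_le_natDegree_swap f n).trans hs))]
    simp [coeffXY]
  · rw [coeff_eq_zero_of_natDegree_lt (by omega), eval_zero]

theorem sliceY_infty {d : ℕ} {f : ℂ[X][Y]} (hf : f.natDegree ≤ d) :
    sliceY d f (hcoords OnePoint.infty) = (swap f).coeff d := by
  ext n
  rw [coeff_sliceY, hcoords_infty, coeff_coeff_swap]
  split_ifs with h
  · rw [Finset.sum_eq_single_of_mem d (by simp)]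
    · simp [coeffXY]
    · intro i hi hne
      have : d - i ≠ 0 := by simp at hi; omega
      simp [this]
  · rw [coeff_eq_zero_of_natDegree_lt (p := f) (by omega), coeff_zero]

theorem biform_coe (d : ℕ) (f : ℂ[X][Y]) (p : ℂ × ℂ) (w : ℂ) :
    biform d f p (hcoords w) = (sliceY d f p).eval w := by
  rw [eval_eq_sum_range' (Nat.lt_succ_of_le (natDegree_sliceY_le d f p)), biform,
    Finset.sum_comm]
  refine Finset.sum_congr rfl fun j hj => ?_
  rw [coeff_sliceY, if_pos (by simpa [Nat.lt_succ_iff] using hj), Finset.sum_mul, hcoords_coe]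
  simp

theorem biform_infty (d : ℕ) (f : ℂ[X][Y]) (p : ℂ × ℂ) :
    biform d f p (hcoords OnePoint.infty) = (sliceY d f p).coeff d := by
  rw [coeff_sliceY, if_pos le_rfl, biform, hcoords_infty]
  refine Finset.sum_congr rfl fun i _ => ?_
  rw [Finset.sum_eq_single_of_mem d (by simp)]
  · simp
  · intro j hj hne
    have : d - j ≠ 0 := by simp at hj; omega
    simp [this]

theorem vertical_subset_graph_iff {d : ℕ} {f : ℂ[X][Y]} {a : OnePoint ℂ} :
    ({a} : Set (OnePoint ℂ)) ×ˢ Set.univ ⊆ graph d f ↔ sliceY d f (hcoords a) = 0 := by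
  constructor
  · intro h
    refine Polynomial.funext fun w => ?_
    have : (a, (w : OnePoint ℂ)) ∈ graph d f := h (by simp)
    rw [← biform_coe, eval_zero]
    exact this
  · rintro h ⟨x, y⟩ hxy
    obtain rfl : x = a := by simpa using hxy
    change biform d f (hcoords x) (hcoords y) = 0
    induction y using OnePoint.rec with
    | infty => rw [biform_infty, h, coeff_zero]
    | coe w => rw [biform_coe, h, eval_zero]

theorem horizontal_subset_graph_iff {d : ℕ} {f : ℂ[X][Y]} {a : OnePoint ℂ} :
    Set.univ ×ˢ ({a} : Set (OnePoint ℂ)) ⊆ graph d f ↔ sliceY d (swap f) (hcoords a) = 0 := by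
  rw [← vertical_subset_graph_iff]
  constructor
  · rintro h ⟨x, y⟩ hxy
    have : (y, x) ∈ graph d f := h (by simpa using hxy)
    exact (biform_swap d f _ _).trans this
  · rintro h ⟨x, y⟩ hxy
    have : (y, x) ∈ graph d (swap f) := h (by simpa using hxy)
    exact (biform_swap d f _ _).symm.trans this

theorem IsCorrespondence.sliceY_ne_zero {d : ℕ} {f : ℂ[X][Y]} (hf : IsCorrespondence d f)
    (a : OnePoint ℂ) : sliceY d f (hcoords a) ≠ 0 :=
  fun h => hf.no_vertical a (vertical_subset_graph_iff.2 h)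

theorem IsCorrespondence.swap {d : ℕ} {f : ℂ[X][Y]} (hf : IsCorrespondence d f) :
    IsCorrespondence d (swap f) where
  generic_x := by simpa only [eval_C_eq_map_swap] using hf.generic_y
  generic_y := by
    simpa only [eval_C_eq_map_swap, swap_swap_apply] using hf.generic_x
  no_vertical a := by
    rw [vertical_subset_graph_iff, ← horizontal_subset_graph_iff]
    exact hf.no_horizontal a
  no_horizontal a := by
    rw [horizontal_subset_graph_iff, swap_swap_apply, ← vertical_subset_graph_iff]
    exact hf.no_vertical a

theorem IsCorrespondence.ne_zero {d : ℕ} {f : ℂ[X][Y]} (hf : IsCorrespondence d f) : f ≠ 0 := by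
  rintro rfl
  refine hf.sliceY_ne_zero OnePoint.infty ?_
  rw [sliceY_infty (by simp)]
  simp

theorem IsCorrespondence.natDegree_eq {d : ℕ} {f : ℂ[X][Y]} (hf : IsCorrespondence d f) :
    f.natDegree = d := by
  have hlc : f.leadingCoeff ≠ 0 := leadingCoeff_ne_zero.2 hf.ne_zero
  obtain ⟨x, hx⟩ := (hf.generic_x.union f.leadingCoeff.roots.toFinset.finite_toSet).exists_notMem
  simp only [Set.mem_union, Set.mem_ofPred_eq, not_or, not_not, Finset.mem_coe,
    Multiset.mem_toFinset, mem_roots hlc, IsRoot.def] at hx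
  rw [← hx.1, ← natDegree_map_of_leadingCoeff_ne_zero (evalRingHom x) hx.2]
  exact (IsAlgClosed.splits _).natDegree_eq_card_roots

theorem IsCorrespondence.natDegree_swap_eq {d : ℕ} {f : ℂ[X][Y]} (hf : IsCorrespondence d f) :
    (Bivariate.swap f).natDegree = d :=
  hf.swap.natDegree_eq

theorem IsCorrespondence.map_ne_zero {d : ℕ} {f : ℂ[X][Y]} (hf : IsCorrespondence d f) (x : ℂ) :
    f.map (evalRingHom x) ≠ 0 := by
  rw [← sliceY_coe hf.natDegree_eq.le hf.natDegree_swap_eq.le]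
  exact hf.sliceY_ne_zero _

/-- A bivariate polynomial with the right bidegree is a correspondence as soon as its zero locus
contains no line. -/
theorem isCorrespondence_of_sliceY_ne_zero {d : ℕ} {f : ℂ[X][Y]} (hx : f.natDegree = d)
    (hy : (swap f).natDegree = d) (hv : ∀ a, sliceY d f (hcoords a) ≠ 0)
    (hh : ∀ a, sliceY d (swap f) (hcoords a) ≠ 0) : IsCorrespondence d f := by
  have key : ∀ g : ℂ[X][Y], g ≠ 0 → g.natDegree = d →
      {x : ℂ | Multiset.card (g.map (evalRingHom x)).roots ≠ d}.Finite := by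
    intro g hg hgd
    refine g.leadingCoeff.roots.toFinset.finite_toSet.subset fun x hx => ?_
    rw [Finset.mem_coe, Multiset.mem_toFinset, mem_roots (leadingCoeff_ne_zero.2 hg), IsRoot.def]
    by_contra hne
    apply hx
    rw [← hgd, ← natDegree_map_of_leadingCoeff_ne_zero (evalRingHom x) hne]
    exact (IsAlgClosed.splits _).natDegree_eq_card_roots.symm
  have hf0 : f ≠ 0 := by
    rintro rfl
    exact hv OnePoint.infty (by rw [sliceY_infty (by simp)]; simp)
  exact ⟨key f hf0 hx, by simpa only [eval_C_eq_map_swap] using key (swap f) (by simpa) hy,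
    fun a => by rw [vertical_subset_graph_iff]; exact hv a,
    fun a => by rw [horizontal_subset_graph_iff]; exact hh a⟩

/-! ### Zeros of binary forms on the sphere -/

theorem count_coe_sphereRoots [DecidableEq (OnePoint ℂ)] (d : ℕ) (p : ℂ[X]) (z : ℂ) :
    (sphereRoots d p).count (z : OnePoint ℂ) = p.rootMultiplicity z := by
  rw [sphereRoots, Multiset.count_add, Multiset.count_map_eq_count' _ _ OnePoint.coe_injective,
    count_roots, Multiset.count_replicate, if_neg (OnePoint.infty_ne_coe z), add_zero]

/-- Over ℂ the finite roots already determine a polynomial up to its leading coefficient. -/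
theorem eq_C_mul_of_sphereRoots_eq {d : ℕ} {p q : ℂ[X]} (hp : p ≠ 0) (hq : q ≠ 0)
    (h : sphereRoots d p = sphereRoots d q) : ∃ c : ℂ, c ≠ 0 ∧ p = C c * q := by
  classical
  have hr : p.roots = q.roots := by
    ext z
    rw [count_roots, count_roots, ← count_coe_sphereRoots d, h, count_coe_sphereRoots]
  have hp' := (IsAlgClosed.splits p).eq_prod_roots
  have hq' := (IsAlgClosed.splits q).eq_prod_roots
  have hq0 : q.leadingCoeff ≠ 0 := leadingCoeff_ne_zero.2 hq
  refine ⟨p.leadingCoeff / q.leadingCoeff, by simp [hp, hq], ?_⟩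
  rw [hq', ← mul_assoc, ← C_mul, ← hq', div_mul_cancel₀ _ hq0, ← hr]
  exact hp'

theorem sphereRoots_C_mul (d : ℕ) {c : ℂ} (hc : c ≠ 0) (p : ℂ[X]) :
    sphereRoots d (C c * p) = sphereRoots d p := by
  rw [sphereRoots, sphereRoots, roots_C_mul _ hc, natDegree_C_mul hc]

theorem sphereRoots_pow (k m : ℕ) (p : ℂ[X]) :
    sphereRoots (m * k) (p ^ m) = m • sphereRoots k p := by
  rw [sphereRoots, sphereRoots, roots_pow, natDegree_pow, nsmul_add, Multiset.map_nsmul,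
    Multiset.nsmul_replicate, Nat.mul_sub]

/-- Every point of a fibre lies on the completed curve. -/
theorem biform_eq_zero_of_mem_fiberY {d : ℕ} {f : ℂ[X][Y]} {a b : OnePoint ℂ}
    (h : b ∈ fiberY d f a) : biform d f (hcoords a) (hcoords b) = 0 := by
  rw [fiberY, sphereRoots, Multiset.mem_add] at h
  induction b using OnePoint.rec with
  | infty =>
    rw [biform_infty]
    have h := h.resolve_left (by simp)
    rw [Multiset.mem_replicate] at h
    exact coeff_eq_zero_of_natDegree_lt (by omega)
  | coe w =>
    have h := h.resolve_right fun h => OnePoint.coe_ne_infty w (Multiset.eq_of_mem_replicate h)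
    obtain ⟨z, hz, hzw⟩ := Multiset.mem_map.1 h
    rw [← OnePoint.coe_injective hzw, biform_coe]
    exact (mem_roots'.1 hz).2

theorem coe_mem_fiberY {d : ℕ} {f : ℂ[X][Y]} {a : OnePoint ℂ} {w : ℂ}
    (h0 : sliceY d f (hcoords a) ≠ 0) (h : (sliceY d f (hcoords a)).eval w = 0) :
    (w : OnePoint ℂ) ∈ fiberY d f a := by
  rw [fiberY, sphereRoots, Multiset.mem_add]
  exact Or.inl (Multiset.mem_map_of_mem _ ((mem_roots h0).2 h))

theorem IsMapOfTuples.swap {d : ℕ} {f : ℂ[X][Y]} (hf : IsMapOfTuples d f) :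
    IsMapOfTuples d (swap f) where
  corr := hf.corr.swap
  coincide_x := by simpa only [← fiberX_eq_fiberY_swap, ← fiberY_eq_fiberX_swap] using hf.coincide_y
  coincide_y := by simpa only [← fiberX_eq_fiberY_swap, ← fiberY_eq_fiberX_swap] using hf.coincide_x

/-! ### Bilinear equations and separated variables -/

/-- The value of the degree `d` homogenization of `p` at the homogeneous coordinates of `a`. -/
def homEval (d : ℕ) (p : ℂ[X]) (a : OnePoint ℂ) : ℂ :=
  ∑ i ∈ Finset.range (d + 1), p.coeff i * ((hcoords a).2 ^ i * (hcoords a).1 ^ (d - i))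

theorem homEval_coe {d : ℕ} {p : ℂ[X]} (hp : p.natDegree ≤ d) (z : ℂ) :
    homEval d p z = p.eval z := by
  rw [homEval, hcoords_coe, eval_eq_sum_range' (Nat.lt_succ_of_le hp)]
  simp

theorem homEval_infty (d : ℕ) (p : ℂ[X]) : homEval d p OnePoint.infty = p.coeff d := by
  rw [homEval, hcoords_infty, Finset.sum_eq_single_of_mem d (by simp)]
  · simp
  · intro i hi hne
    have : d - i ≠ 0 := by simp at hi; omega
    simp [this]

theorem coeffXY_bilinear (P Q a b : ℂ[X]) (i j : ℕ) :
    coeffXY (C P * a.map C + C Q * b.map C) i j =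
      P.coeff i * a.coeff j + Q.coeff i * b.coeff j := by
  simp [coeffXY]

theorem swap_bilinear (P Q a b : ℂ[X]) :
    swap (C P * a.map C + C Q * b.map C) = C a * P.map C + C b * Q.map C := by
  rw [map_add, map_mul, map_mul, swap_C, swap_C, swap_map_C, swap_map_C]
  ring

theorem sliceY_bilinear {d : ℕ} {a b : ℂ[X]} (P Q : ℂ[X]) (ha : a.natDegree ≤ d)
    (hb : b.natDegree ≤ d) (z : OnePoint ℂ) :
    sliceY d (C P * a.map C + C Q * b.map C) (hcoords z) =
      C (homEval d P z) * a + C (homEval d Q z) * b := by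
  ext n
  rw [coeff_sliceY, coeff_add, coeff_C_mul, coeff_C_mul]
  split_ifs with h
  · simp only [coeffXY_bilinear, homEval, Finset.sum_mul, ← Finset.sum_add_distrib]
    exact Finset.sum_congr rfl fun i _ => by ring
  · rw [coeff_eq_zero_of_natDegree_lt (p := a) (by omega),
      coeff_eq_zero_of_natDegree_lt (p := b) (by omega)]
    simp

theorem biform_bilinear (d : ℕ) (P Q a b : ℂ[X]) (z w : OnePoint ℂ) :
    biform d (C P * a.map C + C Q * b.map C) (hcoords z) (hcoords w) =
      homEval d P z * homEval d a w + homEval d Q z * homEval d b w := by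
  simp only [biform, coeffXY_bilinear, homEval, Finset.sum_mul_sum, ← Finset.sum_add_distrib]
  exact Finset.sum_congr rfl fun i _ => Finset.sum_congr rfl fun j _ => by ring

/-- A common zero of the two homogenizations would carry a vertical line. -/
theorem homEval_ne_zero_of_isCorrespondence {d : ℕ} {P Q a b : ℂ[X]} (ha : a.natDegree ≤ d)
    (hb : b.natDegree ≤ d) (h : IsCorrespondence d (C P * a.map C + C Q * b.map C))
    (z : OnePoint ℂ) : homEval d P z ≠ 0 ∨ homEval d Q z ≠ 0 := by
  by_contra! hz
  apply h.sliceY_ne_zero z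
  rw [sliceY_bilinear P Q ha hb, hz.1, hz.2]
  simp

theorem fiberX_eq_of_bilinear {d : ℕ} {P Q a b : ℂ[X]} (hP : P.natDegree ≤ d)
    (hQ : Q.natDegree ≤ d) (ha : a.natDegree ≤ d) (hb : b.natDegree ≤ d)
    (h : IsCorrespondence d (C P * a.map C + C Q * b.map C)) {x y : OnePoint ℂ}
    (hy : y ∈ fiberY d (C P * a.map C + C Q * b.map C) x) :
    fiberX d (C P * a.map C + C Q * b.map C) y =
      sphereRoots d (C (homEval d Q x) * P - C (homEval d P x) * Q) := by
  have hs := h.swap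
  rw [swap_bilinear] at hs
  have h1 := homEval_ne_zero_of_isCorrespondence ha hb h x
  have h2 := homEval_ne_zero_of_isCorrespondence hP hQ hs y
  have h3 := biform_eq_zero_of_mem_fiberY hy
  rw [biform_bilinear] at h3
  rw [fiberX_eq_fiberY_swap, fiberY, swap_bilinear, sliceY_bilinear a b hP hQ]
  generalize homEval d P x = p at *
  generalize homEval d Q x = q at *
  generalize homEval d a y = u at *
  generalize homEval d b y = v at *
  -- The relation `p * u + q * v = 0` with `(p, q) ≠ 0` makes `(u, v)` a multiple of `(q, -p)`.
  obtain ⟨c, rfl, rfl⟩ : ∃ c, u = c * q ∧ v = -(c * p) := by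
    by_cases hp : p = 0
    · subst hp
      have hq : q ≠ 0 := by simpa using h1
      refine ⟨u / q, by field_simp, ?_⟩
      simpa [hq] using h3
    · refine ⟨-v / p, ?_, by field_simp⟩
      field_simp
      linear_combination h3
  have hc : c ≠ 0 := by
    rintro rfl
    simp at h2
  conv_rhs => rw [← sphereRoots_C_mul d hc]
  congr 1
  simp only [C_mul, C_neg]
  ring

theorem isMapOfTuples_of_bilinear {d : ℕ} {P Q a b : ℂ[X]} (hP : P.natDegree ≤ d)
    (hQ : Q.natDegree ≤ d) (ha : a.natDegree ≤ d) (hb : b.natDegree ≤ d)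
    (h : IsCorrespondence d (C P * a.map C + C Q * b.map C)) :
    IsMapOfTuples d (C P * a.map C + C Q * b.map C) := by
  have hs := h.swap
  refine ⟨h, fun x y hy y' hy' => ?_, fun y x hx x' hx' => ?_⟩
  · rw [fiberX_eq_of_bilinear hP hQ ha hb h hy, fiberX_eq_of_bilinear hP hQ ha hb h hy']
  · rw [fiberY_eq_fiberX_swap, fiberY_eq_fiberX_swap]
    rw [fiberX_eq_fiberY_swap] at hx hx'
    rw [swap_bilinear] at *
    rw [fiberX_eq_of_bilinear ha hb hP hQ hs hx, fiberX_eq_of_bilinear ha hb hP hQ hs hx']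

theorem separatedPoly_eq_bilinear (Φ Ψ : RatFunc ℂ) (c : ℂ) :
    C (C c) * separatedPoly Φ Ψ =
      C (C c * Φ.num) * Ψ.denom.map C + C (C c * Φ.denom) * (-Ψ.num).map C := by
  simp only [separatedPoly, C_mul, Polynomial.map_neg]
  ring

theorem IsSeparable.isMapOfTuples {d : ℕ} {f : ℂ[X][Y]} (hf : IsCorrespondence d f)
    (h : IsSeparable d f) : IsMapOfTuples d f := by
  obtain ⟨Φ, Ψ, hΦ, hΨ, c, hc, rfl⟩ := h
  rw [separatedPoly_eq_bilinear] at *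
  rw [ratDegree] at hΦ hΨ
  refine isMapOfTuples_of_bilinear ?_ ?_ ?_ ?_ hf
  · rw [natDegree_C_mul hc]; omega
  · rw [natDegree_C_mul hc]; omega
  · omega
  · rw [natDegree_neg]; omega

/-- A pair of polynomials whose degree `d` homogenizations have no common zero is, up to a common
factor, the numerator and denominator of a rational function of degree `d`. -/
theorem exists_ratFunc_of_homEval_ne_zero {d : ℕ} (hd : 1 ≤ d) {P Q : ℂ[X]}
    (hP : P.natDegree ≤ d) (hQ : Q.natDegree ≤ d)
    (h : ∀ z, homEval d P z ≠ 0 ∨ homEval d Q z ≠ 0) :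
    ∃ Φ : RatFunc ℂ, ratDegree Φ = d ∧
      ∃ e : ℂ, e ≠ 0 ∧ P = C e * Φ.num ∧ Q = C e * Φ.denom := by
  classical
  have hfin : ∀ z : ℂ, P.eval z ≠ 0 ∨ Q.eval z ≠ 0 := fun z => by
    simpa only [homEval_coe hP, homEval_coe hQ] using h z
  have hinf : P.coeff d ≠ 0 ∨ Q.coeff d ≠ 0 := by
    simpa only [homEval_infty] using h OnePoint.infty
  -- If `Q = 0`, then `P` has degree `d ≥ 1`, and any root of it is a common zero.
  have hQ0 : Q ≠ 0 := by
    rintro rfl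
    simp only [coeff_zero, ne_eq, not_true, or_false, eval_zero] at hinf hfin
    have hdeg : P.degree ≠ 0 := fun h0 => by
      have := le_natDegree_of_ne_zero hinf
      rw [natDegree_eq_zero_iff_degree_le_zero.2 h0.le] at this
      omega
    obtain ⟨z, hz⟩ := IsAlgClosed.exists_root P hdeg
    exact hfin z hz
  have hcop : IsCoprime P Q := by
    rw [isCoprime_iff_aeval_ne_zero_of_isAlgClosed ℂ ℂ]
    simpa using hfin
  -- `RatFunc` normalizes by the gcd, here a constant `u`, and makes the denominator monic through
  -- `l`; hence the factor `e = u * l`.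
  obtain ⟨u, hu, hgcd⟩ := Polynomial.isUnit_iff.1 ((gcd_isUnit_iff P Q).2 hcop)
  have hu0 : u ≠ 0 := hu.ne_zero
  have hnum := RatFunc.num_div P Q
  have hden := RatFunc.denom_div P hQ0
  set Φ : RatFunc ℂ := algebraMap _ _ P / algebraMap _ _ Q
  rw [← hgcd, div_C, div_C, mul_comm P, mul_comm Q] at hnum
  rw [← hgcd, div_C, mul_comm Q] at hden
  have hl0 : (C u⁻¹ * Q).leadingCoeff ≠ 0 := by simp [hu0, hQ0]
  set l := (C u⁻¹ * Q).leadingCoeff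
  have hP' : P = C (u * l) * Φ.num := by
    rw [hnum, ← mul_assoc, ← mul_assoc, ← C_mul, ← C_mul]
    field_simp
    simp
  have hQ' : Q = C (u * l) * Φ.denom := by
    rw [hden, ← mul_assoc, ← mul_assoc, ← C_mul, ← C_mul]
    field_simp
    simp
  refine ⟨Φ, ?_, u * l, mul_ne_zero hu0 hl0, hP', hQ'⟩
  rw [ratDegree, ← natDegree_C_mul (p := Φ.num) (mul_ne_zero hu0 hl0),
    ← natDegree_C_mul (p := Φ.denom) (mul_ne_zero hu0 hl0), ← hP', ← hQ']
  rcases hinf with hc | hc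
  · have := le_natDegree_of_ne_zero hc; omega
  · have := le_natDegree_of_ne_zero hc; omega

theorem isSeparable_of_bilinear {d : ℕ} (hd : 1 ≤ d) {P Q a b : ℂ[X]} (hP : P.natDegree ≤ d)
    (hQ : Q.natDegree ≤ d) (ha : a.natDegree ≤ d) (hb : b.natDegree ≤ d)
    (h : IsCorrespondence d (C P * a.map C + C Q * b.map C)) :
    IsSeparable d (C P * a.map C + C Q * b.map C) := by
  have hs := h.swap
  rw [swap_bilinear] at hs
  obtain ⟨Φ, hΦ, e, he, hPe, hQe⟩ := exists_ratFunc_of_homEval_ne_zero hd hP hQ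
    (homEval_ne_zero_of_isCorrespondence ha hb h)
  have hb' : (-b).natDegree ≤ d := by rwa [natDegree_neg]
  obtain ⟨Ψ, hΨ, e', he', hbe, hae⟩ := exists_ratFunc_of_homEval_ne_zero hd hb' ha fun z => by
    have hneg : homEval d (-b) z = -homEval d b z := by simp [homEval]
    rw [hneg, neg_ne_zero]
    exact (homEval_ne_zero_of_isCorrespondence hP hQ hs z).symm
  refine ⟨Φ, Ψ, hΦ, hΨ, e * e', mul_ne_zero he he', ?_⟩
  have hb2 : b = -(C e' * Ψ.num) := by rw [← hbe, neg_neg]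
  conv_lhs => rw [hPe, hQe, hae, hb2]
  simp only [separatedPoly, C_mul, Polynomial.map_neg, Polynomial.map_mul, map_C]
  ring

/-! ### Multiplicities of irreducible factors -/

/-- Two bivariate polynomials, one irreducible and not dividing the other, have common zeros over
finitely many abscissae only. -/
theorem exists_ne_zero_of_irreducible_of_not_dvd {p q : ℂ[X][Y]} (hp : Irreducible p)
    (hdeg : p.natDegree ≠ 0) (hpq : ¬ p ∣ q) :
    ∃ r : ℂ[X], r ≠ 0 ∧ ∀ x y, p.evalEval x y = 0 → q.evalEval x y = 0 → r.eval x = 0 := by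
  have hprim := hp.isPrimitive hdeg
  -- If the resultant vanishes, `p` divides `q` over `ℂ(x)`, hence over `ℂ[x]` by Gauss's lemma;
  -- otherwise its Bézout identity confines the common zeros.
  refine ⟨p.resultant q, fun h => ?_, fun x y hpx hqx => ?_⟩
  · have h' := resultant_map_map p q p.natDegree q.natDegree (algebraMap ℂ[X] (RatFunc ℂ))
    have hinj := IsFractionRing.injective ℂ[X] (RatFunc ℂ)
    rw [h, map_zero, ← natDegree_map_eq_of_injective hinj p,
      ← natDegree_map_eq_of_injective hinj q, resultant_eq_zero_iff,
      ((hprim.irreducible_iff_irreducible_map_fraction_map (K := RatFunc ℂ)).1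
        hp).coprime_iff_not_dvd, not_not,
      ← hprim.dvd_iff_fraction_map_dvd_fraction_map (RatFunc ℂ)] at h'
    exact hpq h'.2
  · obtain ⟨u, v, -, -, huv⟩ := exists_mul_add_mul_eq_C_resultant p q le_rfl le_rfl (Or.inl hdeg)
    rw [← evalEval_C x y, ← huv, evalEval_add, evalEval_mul, evalEval_mul, hpx, hqx]
    simp

theorem not_dvd_derivative {p : ℂ[X][Y]} (hdeg : p.natDegree ≠ 0) : ¬ p ∣ derivative p := by
  have h0 : derivative p ≠ 0 := fun h => hdeg (derivative_eq_zero.1 h)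
  intro h
  exact absurd (natDegree_le_of_dvd h h0) (not_le.2 (natDegree_derivative_lt hdeg))

theorem not_dvd_swap_derivative_swap {p : ℂ[X][Y]} (hdeg : (swap p).natDegree ≠ 0) :
    ¬ p ∣ swap (derivative (swap p)) := by
  intro h
  apply not_dvd_derivative hdeg
  simpa only [swap_swap_apply] using map_dvd swap h

/-- Over a generic abscissa, the zeros of an irreducible factor `p` of `p ^ m * h` are simple in
both directions and are not zeros of `h`. -/
theorem exists_generic_of_irreducible {p h : ℂ[X][Y]} (hp : Irreducible p)
    (hdeg : p.natDegree ≠ 0) (hdeg' : (swap p).natDegree ≠ 0) (hph : ¬ p ∣ h) :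
    ∃ r : ℂ[X], r ≠ 0 ∧ ∀ x, r.eval x ≠ 0 → ∀ y, p.evalEval x y = 0 →
      h.evalEval x y ≠ 0 ∧ (derivative p).evalEval x y ≠ 0 ∧
        (derivative (swap p)).evalEval y x ≠ 0 := by
  -- All three conditions are tested at once through the product of the polynomials that must not
  -- vanish.
  have hq : ¬ p ∣ h * (derivative p * swap (derivative (swap p))) := by
    intro hd
    rcases hp.prime.dvd_or_dvd hd with hd | hd
    · exact hph hd
    · rcases hp.prime.dvd_or_dvd hd with hd | hd
      · exact not_dvd_derivative hdeg hd
      · exact not_dvd_swap_derivative_swap hdeg' hd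
  obtain ⟨r, hr, H⟩ := exists_ne_zero_of_irreducible_of_not_dvd hp hdeg hq
  refine ⟨r, hr, fun x hx y hy => ?_⟩
  have := mt (H x y hy) hx
  rw [evalEval_mul, evalEval_mul, ← evalEval_swap (swap _), swap_swap_apply] at this
  simpa only [ne_eq, mul_eq_zero, not_or] using this

theorem rootMultiplicity_pow_mul {u v : ℂ[X]} {a : ℂ} (hu : u.eval a = 0)
    (hu' : (derivative u).eval a ≠ 0) (hv : v.eval a ≠ 0) (m : ℕ) :
    (u ^ m * v).rootMultiplicity a = m := by
  have hu0 : u ≠ 0 := by rintro rfl; simp at hu'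
  have hv0 : v ≠ 0 := by rintro rfl; simp at hv
  have h1 : u.rootMultiplicity a = 1 := by
    have h2 := (rootMultiplicity_pos hu0).2 hu
    have h3 := mt (one_lt_rootMultiplicity_iff_isRoot hu0).1 fun h => hu' h.2
    omega
  rw [rootMultiplicity_mul (mul_ne_zero (pow_ne_zero m hu0) hv0), rootMultiplicity_eq_zero hv,
    ← count_roots, roots_pow, Multiset.count_nsmul, count_roots, h1]
  simp

theorem eval_derivative_map_swap (p : ℂ[X][Y]) (x y : ℂ) :
    (derivative ((swap p).map (evalRingHom y))).eval x = (derivative (swap p)).evalEval y x := by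
  rw [derivative_map, eval_map_evalRingHom]

/-- A nonunit factor in `x` alone has a root, over which the curve contains a vertical line. -/
theorem natDegree_ne_zero_of_dvd {d : ℕ} {f p : ℂ[X][Y]} (hf : IsCorrespondence d f)
    (hp : ¬ IsUnit p) (hpf : p ∣ f) : p.natDegree ≠ 0 := by
  intro h
  obtain ⟨a, rfl⟩ := natDegree_eq_zero.1 h
  have ha : a.degree ≠ 0 := fun h0 =>
    hp ((Polynomial.isUnit_iff_degree_eq_zero.2 h0).map C)
  obtain ⟨z, hz⟩ := IsAlgClosed.exists_root a ha
  obtain ⟨q, rfl⟩ := hpf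
  apply hf.map_ne_zero z
  rw [Polynomial.map_mul, map_C, coe_evalRingHom, hz.eq_zero]
  simp

theorem natDegree_swap_ne_zero_of_dvd {d : ℕ} {f p : ℂ[X][Y]} (hf : IsCorrespondence d f)
    (hp : ¬ IsUnit p) (hpf : p ∣ f) : (swap p).natDegree ≠ 0 := by
  obtain ⟨q, rfl⟩ := hpf
  have hs := hf.swap
  rw [map_mul] at hs
  refine natDegree_ne_zero_of_dvd hs (fun h => hp ?_) (dvd_mul_right _ _)
  simpa only [swap_swap_apply] using h.map (swap (R := ℂ))

/-- Over a generic abscissa, each zero of an irreducible factor of multiplicity `m` of a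
correspondence has multiplicity `m` in the horizontal direction, and such zeros exist. -/
theorem exists_generic_multiplicity {d : ℕ} {f p h : ℂ[X][Y]} {m : ℕ} (hf : IsCorrespondence d f)
    (hp : Irreducible p) (hm : m ≠ 0) (hfp : f = p ^ m * h) (hph : ¬ p ∣ h) :
    ∃ r : ℂ[X], r ≠ 0 ∧ ∀ x, r.eval x ≠ 0 → ∃ y,
      f.evalEval x y = 0 ∧ ((swap f).map (evalRingHom y)).rootMultiplicity x = m := by
  have hpf : p ∣ f := hfp ▸ (dvd_pow_self p hm).mul_right h
  have hdeg := natDegree_ne_zero_of_dvd hf hp.not_isUnit hpf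
  obtain ⟨r, hr, H⟩ := exists_generic_of_irreducible hp hdeg
    (natDegree_swap_ne_zero_of_dvd hf hp.not_isUnit hpf) hph
  -- Where the leading coefficient of `p` survives, the slice of `p` keeps its positive degree and
  -- so has a root `y`.
  refine ⟨r * p.leadingCoeff, mul_ne_zero hr (leadingCoeff_ne_zero.2 hp.ne_zero), fun x hx => ?_⟩
  rw [eval_mul, mul_ne_zero_iff] at hx
  have hdx : (p.map (evalRingHom x)).degree ≠ 0 := fun h0 => hdeg <| by
    rw [← natDegree_map_of_leadingCoeff_ne_zero (evalRingHom x) hx.2]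
    exact natDegree_eq_zero_iff_degree_le_zero.2 h0.le
  obtain ⟨y, hy⟩ := IsAlgClosed.exists_root _ hdx
  rw [IsRoot.def, eval_map_evalRingHom] at hy
  obtain ⟨h1, -, h3⟩ := H x hx.1 y hy
  refine ⟨y, by rw [hfp, evalEval_mul, evalEval_pow, hy, zero_pow hm, zero_mul], ?_⟩
  rw [hfp, map_mul, map_pow, Polynomial.map_mul, Polynomial.map_pow]
  refine rootMultiplicity_pow_mul ?_ ?_ ?_ m
  · rwa [eval_map_evalRingHom, evalEval_swap]
  · rwa [eval_derivative_map_swap]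
  · rwa [eval_map_evalRingHom, evalEval_swap]

theorem IsCorrespondence.count_coe_fiberX [DecidableEq (OnePoint ℂ)] {d : ℕ} {f : ℂ[X][Y]}
    (hf : IsCorrespondence d f) (x y : ℂ) :
    (fiberX d f y).count (x : OnePoint ℂ) =
      ((Bivariate.swap f).map (evalRingHom y)).rootMultiplicity x := by
  rw [fiberX_eq_fiberY_swap, fiberY, count_coe_sphereRoots,
    sliceY_coe hf.swap.natDegree_eq.le hf.swap.natDegree_swap_eq.le]

theorem IsCorrespondence.coe_mem_fiberY {d : ℕ} {f : ℂ[X][Y]} (hf : IsCorrespondence d f)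
    {x y : ℂ} (h : f.evalEval x y = 0) : (y : OnePoint ℂ) ∈ fiberY d f x := by
  apply PolyCorr.coe_mem_fiberY (hf.sliceY_ne_zero _)
  rwa [sliceY_coe hf.natDegree_eq.le hf.natDegree_swap_eq.le, eval_map_evalRingHom]

/-- All irreducible factors of a map of tuples have the same multiplicity. -/
theorem IsMapOfTuples.multiplicity_eq {d : ℕ} {f p q : ℂ[X][Y]} (hf : IsMapOfTuples d f)
    (hp : Irreducible p) (hq : Irreducible q) (hpf : p ∣ f) (hqf : q ∣ f) :
    multiplicity p f = multiplicity q f := by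
  classical
  have key : ∀ p : ℂ[X][Y], Irreducible p → p ∣ f → ∃ r : ℂ[X], r ≠ 0 ∧ ∀ x, r.eval x ≠ 0 →
      ∃ y, f.evalEval x y = 0 ∧
        ((Bivariate.swap f).map (evalRingHom y)).rootMultiplicity x = multiplicity p f := by
    intro p hp hpf
    have hfin := FiniteMultiplicity.of_not_isUnit hp.not_isUnit hf.corr.ne_zero
    obtain ⟨h, hfh, hph⟩ := hfin.exists_eq_pow_mul_and_not_dvd
    exact exists_generic_multiplicity hf.corr hp (multiplicity_ne_zero.2 hpf) hfh hph
  obtain ⟨r, hr, H⟩ := key p hp hpf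
  obtain ⟨s, hs, H'⟩ := key q hq hqf
  obtain ⟨x, hx⟩ : ∃ x, (r * s).eval x ≠ 0 := by
    by_contra! h
    exact mul_ne_zero hr hs (Polynomial.funext fun x => by simp [h x])
  rw [eval_mul, mul_ne_zero_iff] at hx
  obtain ⟨y, hy, hym⟩ := H x hx.1
  obtain ⟨y', hy', hym'⟩ := H' x hx.2
  have := hf.coincide_x x _ (hf.corr.coe_mem_fiberY hy) _ (hf.corr.coe_mem_fiberY hy')
  rw [← hym, ← hym', ← hf.corr.count_coe_fiberX, ← hf.corr.count_coe_fiberX, this]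

/-! ### Reduction to multiplicity one -/

open UniqueFactorizationMonoid in
/-- An element of a unique factorization monoid whose prime factors all have multiplicity `m` is
an `m`-th power up to a unit. -/
theorem exists_associated_pow_of_multiplicity_eq {R : Type*} [CommMonoidWithZero R]
    [UniqueFactorizationMonoid R] [NormalizationMonoid R] {f : R} {m : ℕ}
    (hf : f ≠ 0) (h : ∀ p, Irreducible p → p ∣ f → multiplicity p f = m) :
    ∃ g, Associated (g ^ m) f := by
  classical
  -- The witness is the radical of `f`.
  refine ⟨(normalizedFactors f).dedup.prod, ?_⟩
  rw [← Multiset.prod_nsmul]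
  convert prod_normalizedFactors hf
  ext p
  rw [Multiset.count_nsmul]
  by_cases hp : p ∈ normalizedFactors f
  · have hirr := irreducible_of_normalized_factor p hp
    have hdvd := dvd_of_mem_normalizedFactors hp
    have hc := emultiplicity_eq_count_normalizedFactors hirr hf
    rw [normalize_normalized_factor p hp] at hc
    rw [← multiplicity_eq_of_emultiplicity_eq_some hc, h p hirr hdvd,
      Multiset.count_eq_one_of_mem (Multiset.nodup_dedup _) (Multiset.mem_dedup.2 hp), mul_one]
  · rw [Multiset.count_eq_zero_of_notMem hp,
      Multiset.count_eq_zero_of_notMem (mt Multiset.mem_dedup.1 hp), mul_zero]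

/-- Units of `ℂ[x][y]` are nonzero constants, which have `m`-th roots. -/
theorem exists_eq_pow_of_associated {f g : ℂ[X][Y]} {m : ℕ} (hm : m ≠ 0)
    (h : Associated (g ^ m) f) : ∃ g' : ℂ[X][Y], f = g' ^ m := by
  obtain ⟨u, rfl⟩ := h
  obtain ⟨a, ha, hau⟩ := Polynomial.isUnit_iff.1 u.isUnit
  obtain ⟨c, hc, rfl⟩ := Polynomial.isUnit_iff.1 ha
  obtain ⟨e, rfl⟩ := IsAlgClosed.exists_pow_nat_eq c (Nat.pos_of_ne_zero hm)
  exact ⟨g * C (C e), by rw [mul_pow, ← hau, ← C_pow, ← C_pow]⟩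

theorem sliceY_pow {k : ℕ} {g : ℂ[X][Y]} (hg : g.natDegree ≤ k) (hg' : (swap g).natDegree ≤ k)
    (m : ℕ) (a : OnePoint ℂ) :
    sliceY (m * k) (g ^ m) (hcoords a) = sliceY k g (hcoords a) ^ m := by
  have h1 : (g ^ m).natDegree ≤ m * k := natDegree_pow_le_of_le m hg
  have h2 : (swap (g ^ m)).natDegree ≤ m * k := by
    rw [map_pow]; exact natDegree_pow_le_of_le m hg'
  induction a using OnePoint.rec with
  | infty => rw [sliceY_infty h1, sliceY_infty hg, map_pow, coeff_pow_of_natDegree_le hg']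
  | coe z => rw [sliceY_coe h1 h2, sliceY_coe hg hg', Polynomial.map_pow]

/-- If a power of a polynomial is a map of tuples, then so is the polynomial. -/
theorem IsMapOfTuples.of_pow {k m : ℕ} {g : ℂ[X][Y]} (hm : m ≠ 0)
    (h : IsMapOfTuples (m * k) (g ^ m)) : IsMapOfTuples k g := by
  have h1 : g.natDegree = k := by
    have := h.corr.natDegree_eq
    rw [natDegree_pow] at this
    exact Nat.eq_of_mul_eq_mul_left (Nat.pos_of_ne_zero hm) this
  have h2 : (Bivariate.swap g).natDegree = k := by
    have := h.corr.natDegree_swap_eq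
    rw [map_pow, natDegree_pow] at this
    exact Nat.eq_of_mul_eq_mul_left (Nat.pos_of_ne_zero hm) this
  have hs := h.swap
  rw [map_pow] at hs
  have h2' : (Bivariate.swap (Bivariate.swap g)).natDegree ≤ k := by rw [swap_swap_apply, h1]
  have hY : ∀ a, fiberY (m * k) (g ^ m) a = m • fiberY k g a := fun a => by
    rw [fiberY, fiberY, sliceY_pow h1.le h2.le, sphereRoots_pow]
  have hX : ∀ a, fiberX (m * k) (g ^ m) a = m • fiberX k g a := fun a => by
    rw [fiberX_eq_fiberY_swap, fiberX_eq_fiberY_swap, map_pow, fiberY, fiberY,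
      sliceY_pow h2.le h2', sphereRoots_pow]
  have hmem : ∀ {a : OnePoint ℂ} {s : Multiset (OnePoint ℂ)}, a ∈ s → a ∈ m • s :=
    fun ha => Multiset.mem_nsmul.2 ⟨hm, ha⟩
  -- Fibres of `g ^ m` are those of `g` taken `m` times, and this multiplication can be cancelled.
  have hinj : Function.Injective fun s : Multiset (OnePoint ℂ) => m • s := nsmul_right_injective hm
  refine ⟨isCorrespondence_of_sliceY_ne_zero h1 h2 (fun a h0 => ?_) (fun a h0 => ?_),
    fun x y hy y' hy' => hinj ?_, fun x y hy y' hy' => hinj ?_⟩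
  · apply h.corr.sliceY_ne_zero a
    rw [sliceY_pow h1.le h2.le, h0, zero_pow hm]
  · apply hs.corr.sliceY_ne_zero a
    rw [sliceY_pow h2.le h2', h0, zero_pow hm]
  · simp only [← hX]
    exact h.coincide_x x y (by rw [hY]; exact hmem hy) y' (by rw [hY]; exact hmem hy')
  · simp only [← hY]
    exact h.coincide_y x y (by rw [hX]; exact hmem hy) y' (by rw [hX]; exact hmem hy')

/-- A map of tuples that is not a proper power of a map of tuples has no multiple factors. -/
theorem IsMapOfTuples.multiplicity_eq_one {d : ℕ} {f : ℂ[X][Y]} (hd : 1 ≤ d)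
    (hf : IsMapOfTuples d f)
    (hpow : ¬ ∃ k : ℕ, k ∣ d ∧ k ≠ d ∧ ∃ g : ℂ[X][Y], IsMapOfTuples k g ∧ f = g ^ (d / k))
    {p : ℂ[X][Y]} (hp : Irreducible p) (hpf : p ∣ f) : multiplicity p f = 1 := by
  by_contra hne
  have hm : multiplicity p f ≠ 0 := multiplicity_ne_zero.2 hpf
  obtain ⟨g, hg⟩ := exists_associated_pow_of_multiplicity_eq hf.corr.ne_zero
    fun q hq hqf => hf.multiplicity_eq hq hp hqf hpf
  obtain ⟨g, hg⟩ := exists_eq_pow_of_associated hm hg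
  generalize multiplicity p f = m at *
  subst hg
  have hdeg := hf.corr.natDegree_eq
  rw [natDegree_pow] at hdeg
  have hk : 0 < g.natDegree := Nat.pos_of_ne_zero fun h => by simp [h] at hdeg; omega
  refine hpow ⟨g.natDegree, ⟨m, by rw [← hdeg, mul_comm]⟩, ?_, g, ?_, ?_⟩
  · intro h
    rw [h] at hdeg
    exact hne (Nat.eq_of_mul_eq_mul_right hd (hdeg.trans (one_mul d).symm))
  · rw [← hdeg] at hf
    exact hf.of_pow hm
  · rw [← hdeg, Nat.mul_div_cancel _ hk]

/-! ### Generic simplicity of fibres -/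

open UniqueFactorizationMonoid in
/-- The generic fibres of a correspondence without multiple factors are simple. -/
theorem IsCorrespondence.exists_generic_nodup {d : ℕ} {f : ℂ[X][Y]} (hf : IsCorrespondence d f)
    (hsq : ∀ p, Irreducible p → p ∣ f → multiplicity p f = 1) :
    ∃ r : ℂ[X], r ≠ 0 ∧ ∀ x, r.eval x ≠ 0 → (f.map (evalRingHom x)).roots.Nodup := by
  classical
  have key : ∀ p ∈ (normalizedFactors f).toFinset, ∃ r : ℂ[X], r ≠ 0 ∧ ∀ x, r.eval x ≠ 0 →
      ∀ y, p.evalEval x y = 0 → (f.map (evalRingHom x)).rootMultiplicity y = 1 := by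
    intro p hp
    rw [Multiset.mem_toFinset] at hp
    have hirr := irreducible_of_normalized_factor p hp
    have hpf := dvd_of_mem_normalizedFactors hp
    have hfin := FiniteMultiplicity.of_not_isUnit hirr.not_isUnit hf.ne_zero
    obtain ⟨h, hfh, hph⟩ := hfin.exists_eq_pow_mul_and_not_dvd
    rw [hsq p hirr hpf] at hfh
    obtain ⟨r, hr, H⟩ := exists_generic_of_irreducible hirr
      (natDegree_ne_zero_of_dvd hf hirr.not_isUnit hpf)
      (natDegree_swap_ne_zero_of_dvd hf hirr.not_isUnit hpf) hph
    refine ⟨r, hr, fun x hx y hy => ?_⟩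
    obtain ⟨h1, h2, -⟩ := H x hx y hy
    rw [hfh, Polynomial.map_mul, Polynomial.map_pow]
    refine rootMultiplicity_pow_mul ?_ ?_ ?_ 1
    · rwa [eval_map_evalRingHom]
    · rwa [derivative_map, eval_map_evalRingHom]
    · rwa [eval_map_evalRingHom]
  choose! r hr H using key
  refine ⟨∏ p ∈ (normalizedFactors f).toFinset, r p, Finset.prod_ne_zero_iff.2 hr,
    fun x hx => Multiset.nodup_iff_count_le_one.2 fun y => ?_⟩
  rw [eval_prod, Finset.prod_ne_zero_iff] at hx
  rw [count_roots]
  by_cases hy : f.evalEval x y = 0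
  -- A zero of `f` is a zero of some irreducible factor, whose generic zeros are simple for `f`.
  · have h0 := evalEval_dvd x y (prod_normalizedFactors hf.ne_zero).symm.dvd
    rw [hy, zero_dvd_iff, evalEval_multiset_prod, Multiset.prod_eq_zero_iff,
      Multiset.mem_map] at h0
    obtain ⟨p, hp, hpy⟩ := h0
    rw [← Multiset.mem_toFinset] at hp
    exact (H p hp x (hx p hp) y hpy).le
  · rw [rootMultiplicity_eq_zero]
    · exact zero_le_one
    · rwa [IsRoot.def, eval_map_evalRingHom]

/-! ### Separating the variables of a map of tuples -/

/-- Some coefficient is not proportional to the leading one, as otherwise the curve would contain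
a line. -/
theorem IsCorrespondence.exists_coeff_not_proportional {d : ℕ} {f : ℂ[X][Y]} (hd : 1 ≤ d)
    (hf : IsCorrespondence d f) :
    ∃ i, ∀ c : ℂ, f.coeff i ≠ C c * f.leadingCoeff := by
  by_contra! h
  choose c hc using h
  -- Otherwise every coefficient is constant and `f` does not involve `x`, against `d ≥ 1`.
  have hdeg : f.leadingCoeff.degree ≠ 0 := fun h0 => by
    have h1 : (Bivariate.swap f).natDegree ≤ 0 := natDegree_swap_le fun j => by
      rw [hc j]
      exact (natDegree_C_mul_le _ _).trans (natDegree_eq_zero_iff_degree_le_zero.2 h0.le).le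
    rw [hf.natDegree_swap_eq] at h1
    omega
  obtain ⟨z, hz⟩ := IsAlgClosed.exists_root _ hdeg
  apply hf.map_ne_zero z
  ext j
  rw [coeff_map, hc j, coe_evalRingHom, eval_mul, hz.eq_zero, mul_zero, coeff_zero]

/-- If all minors vanish, those involving the leading index of `a` give the proportionality
constant. -/
theorem exists_minor_ne_zero {a b : ℂ[X]} (ha : a ≠ 0) (hb : ∀ c : ℂ, b ≠ C c * a) :
    ∃ i j, a.coeff i * b.coeff j - a.coeff j * b.coeff i ≠ 0 := by
  by_contra! h
  have hl : a.leadingCoeff ≠ 0 := leadingCoeff_ne_zero.2 ha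
  apply hb (b.coeff a.natDegree / a.leadingCoeff)
  ext j
  rw [coeff_C_mul]
  field_simp
  rw [leadingCoeff]
  linear_combination h a.natDegree j

/-- If infinitely many specializations of `f` lie in the span of `a` and `b`, then so does `f`
over `ℂ[x]`, with coefficients of no larger degree. -/
theorem exists_eq_bilinear {d : ℕ} {f : ℂ[X][Y]} {a b : ℂ[X]} (ha : a ≠ 0)
    (hb : ∀ c : ℂ, b ≠ C c * a) (hf : (swap f).natDegree ≤ d) {s : Set ℂ} (hs : s.Infinite)
    (h : ∀ x ∈ s, ∃ u v : ℂ, f.map (evalRingHom x) = C u * a + C v * b) :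
    ∃ P Q : ℂ[X], P.natDegree ≤ d ∧ Q.natDegree ≤ d ∧ f = C P * a.map C + C Q * b.map C := by
  obtain ⟨i, j, hD⟩ := exists_minor_ne_zero ha hb
  set D := a.coeff i * b.coeff j - a.coeff j * b.coeff i with hDdef
  have hdeg : ∀ c e : ℂ, ∀ m n : ℕ,
      (C c * f.coeff m - C e * f.coeff n).natDegree ≤ d := fun c e m n =>
    (natDegree_sub_le _ _).trans <| max_le
      ((natDegree_C_mul_le _ _).trans ((natDegree_coeff_le_natDegree_swap f m).trans hf))
      ((natDegree_C_mul_le _ _).trans ((natDegree_coeff_le_natDegree_swap f n).trans hf))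
  -- Cramer's rule for the coefficients at `i` and `j`.
  refine ⟨C (b.coeff j / D) * f.coeff i - C (b.coeff i / D) * f.coeff j,
    C (a.coeff i / D) * f.coeff j - C (a.coeff j / D) * f.coeff i, hdeg _ _ _ _, hdeg _ _ _ _, ?_⟩
  refine Polynomial.ext fun n => eq_of_infinite_eval_eq _ _ (hs.mono fun x hx => ?_)
  obtain ⟨u, v, huv⟩ := h x hx
  have hcoeff : ∀ n, (f.coeff n).eval x = u * a.coeff n + v * b.coeff n := fun n => by
    simpa using congrArg (fun p => coeff p n) huv
  simp only [Set.mem_ofPred_eq, coeff_add, coeff_C_mul, coeff_map, eval_add, eval_mul, eval_sub,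
    eval_C, hcoeff]
  field_simp
  rw [hDdef]
  ring

/-- Distinct roots make `p` divide `q`, and the degrees leave a constant quotient. -/
theorem eq_C_mul_of_roots_nodup {p q : ℂ[X]} (hq : q ≠ 0) (hdeg : q.natDegree ≤ p.natDegree)
    (hp : p.roots.Nodup) (h : ∀ y, p.eval y = 0 → q.eval y = 0) : ∃ c : ℂ, p = C c * q := by
  have hp0 : p ≠ 0 := by
    rintro rfl
    exact hq (Polynomial.funext fun y => by simpa using h y)
  have hle : p.roots ≤ q.roots := by
    rw [Multiset.le_iff_subset hp]
    intro y hy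
    exact (mem_roots hq).2 (h y (mem_roots'.1 hy).2)
  obtain ⟨t, ht⟩ := (IsAlgClosed.splits p).dvd_of_roots_le_roots hp0 hle
  have ht0 : t ≠ 0 := by rintro rfl; simp at ht; exact hq ht
  have htd : t.natDegree = 0 := by
    rw [ht, natDegree_mul hp0 ht0] at hdeg
    omega
  obtain ⟨c, rfl⟩ := natDegree_eq_zero.1 htd
  have hc : c ≠ 0 := by rintro rfl; simp at ht0
  exact ⟨c⁻¹, by rw [ht, mul_comm p, ← mul_assoc, ← C_mul, inv_mul_cancel₀ hc, C_1, one_mul]⟩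

/-- The horizontal slices of a map of tuples through two points over the same abscissa are
proportional. -/
theorem IsMapOfTuples.exists_map_eq_C_mul {d : ℕ} {f : ℂ[X][Y]} (hf : IsMapOfTuples d f)
    {x y y' : ℂ} (hy : f.evalEval x y = 0) (hy' : f.evalEval x y' = 0) :
    ∃ c : ℂ, (Bivariate.swap f).map (evalRingHom y) =
      C c * (Bivariate.swap f).map (evalRingHom y') := by
  have h := hf.coincide_x x _ (hf.corr.coe_mem_fiberY hy) _ (hf.corr.coe_mem_fiberY hy')
  rw [fiberX_eq_fiberY_swap, fiberX_eq_fiberY_swap, fiberY, fiberY,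
    sliceY_coe hf.swap.corr.natDegree_eq.le hf.swap.corr.natDegree_swap_eq.le,
    sliceY_coe hf.swap.corr.natDegree_eq.le hf.swap.corr.natDegree_swap_eq.le] at h
  obtain ⟨c, -, hc⟩ :=
    eq_C_mul_of_sphereRoots_eq (hf.swap.corr.map_ne_zero y) (hf.swap.corr.map_ne_zero y') h
  exact ⟨c, hc⟩

theorem IsMapOfTuples.isSeparable {d : ℕ} {f : ℂ[X][Y]} (hd : 1 ≤ d) (hf : IsMapOfTuples d f)
    (hsq : ∀ p, Irreducible p → p ∣ f → multiplicity p f = 1) : IsSeparable d f := by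
  obtain ⟨r, hr, hnodup⟩ := hf.corr.exists_generic_nodup hsq
  have hs := hf.swap.corr
  obtain ⟨i, hi⟩ := hs.exists_coeff_not_proportional hd
  have ha : (Bivariate.swap f).leadingCoeff ≠ 0 := leadingCoeff_ne_zero.2 hs.ne_zero
  have had : ∀ j, ((Bivariate.swap f).coeff j).natDegree ≤ d := fun j => by
    have := natDegree_coeff_le_natDegree_swap (Bivariate.swap f) j
    rwa [swap_swap_apply, hf.corr.natDegree_eq] at this
  have hcoeff : ∀ (j : ℕ) (y : ℂ), ((Bivariate.swap f).map (evalRingHom y)).coeff j =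
      ((Bivariate.swap f).coeff j).eval y := fun j y => by rw [coeff_map, coe_evalRingHom]
  have had' : (Bivariate.swap f).leadingCoeff.natDegree ≤ d := had _
  have hprop : ∀ x y y' : ℂ, f.evalEval x y = 0 → f.evalEval x y' = 0 → ∃ c : ℂ,
      (Bivariate.swap f).leadingCoeff.eval y = c * (Bivariate.swap f).leadingCoeff.eval y' ∧
      ((Bivariate.swap f).coeff i).eval y = c * ((Bivariate.swap f).coeff i).eval y' := by
    intro x y y' hy hy'
    obtain ⟨c, hc⟩ := hf.exists_map_eq_C_mul hy hy'
    refine ⟨c, ?_, ?_⟩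
    · rw [leadingCoeff, ← hcoeff, ← hcoeff, hc, coeff_C_mul]
    · rw [← hcoeff, ← hcoeff, hc, coeff_C_mul]
  have hbd := had i
  generalize (Bivariate.swap f).coeff i = b at *
  generalize (Bivariate.swap f).leadingCoeff = a at *
  -- The zeros of `e` are the abscissae to avoid: `r` keeps the fibre simple, `f.leadingCoeff` keeps
  -- its degree `d`, and the product keeps the roots of `a` off the fibre.
  set e : ℂ[X] := r * f.leadingCoeff * ∏ w ∈ a.roots.toFinset, f.eval (C w) with he
  have he0 : e ≠ 0 := by
    refine mul_ne_zero (mul_ne_zero hr (leadingCoeff_ne_zero.2 hf.corr.ne_zero))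
      (Finset.prod_ne_zero_iff.2 fun w _ => ?_)
    rw [eval_C_eq_map_swap]
    exact hs.map_ne_zero w
  have hinf : {x : ℂ | e.eval x ≠ 0}.Infinite :=
    ((finite_setOfPred_isRoot he0).infinite_compl : ({x | e.IsRoot x}ᶜ : Set ℂ).Infinite)
  obtain ⟨P, Q, hP, hQ, rfl⟩ := exists_eq_bilinear ha hi hf.corr.natDegree_swap_eq.le hinf
    fun x hx => by
      rw [Set.mem_ofPred_eq, he, eval_mul, eval_mul, eval_prod, mul_ne_zero_iff,
        mul_ne_zero_iff, Finset.prod_ne_zero_iff] at hx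
      obtain ⟨⟨hxr, hxl⟩, hxa⟩ := hx
      have hdeg : (f.map (evalRingHom x)).natDegree = d := by
        rw [natDegree_map_of_leadingCoeff_ne_zero _ hxl, hf.corr.natDegree_eq]
      obtain ⟨y, hy⟩ := IsAlgClosed.exists_root (f.map (evalRingHom x)) fun h0 => by
        rw [natDegree_eq_zero_iff_degree_le_zero.2 h0.le] at hdeg
        omega
      rw [IsRoot.def, eval_map_evalRingHom] at hy
      have hay : a.eval y ≠ 0 := fun h0 =>
        hxa y (Multiset.mem_toFinset.2 ((mem_roots ha).2 h0)) hy
      -- As `a` does not vanish at `y` and `b` is not a multiple of `a`, this combination is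
      -- nonzero; it vanishes on the whole fibre because `[a : b]` is constant there.
      obtain ⟨c, hc⟩ := eq_C_mul_of_roots_nodup (q := C (b.eval y) * a - C (a.eval y) * b)
        (fun h0 => hi (b.eval y / a.eval y) <| by
          rw [div_eq_inv_mul, C_mul, mul_assoc, sub_eq_zero.1 h0, ← mul_assoc, ← C_mul,
            inv_mul_cancel₀ hay, C_1, one_mul])
        (hdeg.symm ▸ (natDegree_sub_le _ _).trans (max_le ((natDegree_C_mul_le _ _).trans had')
          ((natDegree_C_mul_le _ _).trans hbd)))
        (hnodup x hxr) (fun y' hy' => by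
          rw [eval_map_evalRingHom] at hy'
          obtain ⟨c, hca, hcb⟩ := hprop x y' y hy' hy
          rw [eval_sub, eval_mul, eval_mul, eval_C, eval_C, hca, hcb]
          ring)
      refine ⟨c * b.eval y, -(c * a.eval y), ?_⟩
      rw [hc]
      simp only [C_mul, C_neg]
      ring
  exact isSeparable_of_bilinear hd hP hQ had' hbd hf.corr

end PolyCorr

end

theorem theorem2p3 (d : ℕ) (hd : 1 ≤ d) (f : Polynomial (Polynomial ℂ))
    (hf : PolyCorr.IsCorrespondence d f)
    (hpow : ¬ ∃ k : ℕ, k ∣ d ∧ k ≠ d ∧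
      ∃ g : Polynomial (Polynomial ℂ), PolyCorr.IsMapOfTuples k g ∧ f = g ^ (d / k)) :
    PolyCorr.IsMapOfTuples d f ↔ PolyCorr.IsSeparable d f :=
  ⟨fun h => h.isSeparable hd fun _ hp hpf => h.multiplicity_eq_one hd hpow hp hpf,
    fun h => h.isMapOfTuples hf⟩
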